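/- Let $X$ be a compact metrizable space, let $\theta\colon X\to X$ be a Borel measurable map preserving a Borel probability measure $\mu$ on $X$ (for instance a continuous map preserving $\mu$), and let $(t_\ell)_{\ell\ge1}$ be a sequence of integers with $t_1\ge1$ and $t_{\ell+1}=2t_\ell$ for all $\ell\ge1$. For each integer $n\ge1$ let $\varphi(n,\cdot)\colon X\to\mathbb{R}\cup\{-\infty\}$ be a measurable function such that for all $k_1,k_2\ge1$ $$\varphi(k_1+k_2,x)\le\varphi(k_1,x)+\varphi(k_2,\theta^{k_1}(x))\qquad\text{for }\mu\text{-a.e. }x\in X,$$ and suppose that (a) $\varphi(n,\cdot)\in L^1(X,\mu)$ for all $n\ge1$, and (b) there is a $\mu$-integrable function $g\colon X\to\mathbb{R}$ such that $g\le\frac1n\varphi(n,\cdot)$ $\mu$-a.e. for every $n\ge1$. Then there exist a measurable $\mu$-integrable function $\bar\varphi\colon X\to\mathbb{R}$ with $$\int_X\bar\varphi\,d\mu=\lim_{n\to\infty}\frac1n\int_X\varphi(n,x)\,\mu(dx)=\inf_{n\ge1}\frac1n\int_X\varphi(n,x)\,\mu(dx)$$ and a Borel set $\widehat\Gamma\subset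 X$ with $\mu(\widehat\Gamma)=1$ such that for every $x\in\widehat\Gamma$ $$\bar\varphi(x)=\lim_{n\to\infty}\frac1n\varphi(n,x),\qquad \bar\varphi(\theta^n(x))=\bar\varphi(x)\quad\text{for all }n>0,$$ and, for every $\ell\ge1$, the inner limit below exists and is finite, and $$\lim_{\ell\to\infty}\left\{\lim_{k\to\infty}\frac1k\sum_{j=0}^{k-1}\frac1{t_\ell}\varphi\bigl(t_\ell,\theta^{jt_\ell}(x)\bigr)\right\}=\bar\varphi(x).$$ -/

import Mathlib

open MeasureTheory Filter Topology

/-!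
Cut an orbit greedily into blocks of bounded length on which the cocycle is nonpositive. Where such
blocks exist almost everywhere, this shows that the mean growth rate of the cocycle is nonpositive;
hence a cocycle whose conditional means given the invariant sets grow linearly is almost everywhere
bounded below. Let `Φ` be the limit of the conditional means of `f n / n`, which exists by Fekete's
lemma. Applied to `f n - n (Φ - ε)`, the boundedness gives `liminf f n / n ≥ Φ`; applied to
Birkhoff sums and to their negatives, it gives Birkhoff's theorem.

For the upper bound, cut an orbit into blocks of a fixed length `t`. By Birkhoff's theorem for
`T^[t]` the average `A t` of `f t / t` over these blocks exists, and `Φ ≤ limsup f n / n ≤ A t`.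
Along a chain of lengths each dividing the next, the functions `A t` decrease and their integrals
tend to `∫ Φ`, so they converge to `Φ` almost everywhere, and so does `f n / n`.
-/

/-! ### Subadditivity along an orbit -/

section Orbit

variable {α : Type*} {T : α → α} {f : ℕ → α → ℝ} {ψ : α → ℝ} {x : α} {N : ℕ}

/-- `f` is a subadditive cocycle over `T` at every point of the forward orbit of `x`. A cocycle in
the measure-theoretic sense has this property at almost every point, where the combinatorial part
of the argument then takes place. -/
structure SubadditiveOnOrbit (T : α → α) (f : ℕ → α → ℝ) (x : α) : Prop where
  zero : ∀ i, f 0 (T^[i] x) = 0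
  add_le : ∀ i m n, f (m + n) (T^[i] x) ≤ f m (T^[i] x) + f n (T^[m] (T^[i] x))

namespace SubadditiveOnOrbit

theorem iterate (h : SubadditiveOnOrbit T f x) (k : ℕ) : SubadditiveOnOrbit T f (T^[k] x) where
  zero i := by rw [← Function.iterate_add_apply]; exact h.zero _
  add_le i m n := by simp only [← Function.iterate_add_apply T i]; exact h.add_le _ m n

theorem apply_zero (h : SubadditiveOnOrbit T f x) : f 0 x = 0 := h.zero 0

theorem apply_add_le (h : SubadditiveOnOrbit T f x) (m n : ℕ) :
    f (m + n) x ≤ f m x + f n (T^[m] x) := h.add_le 0 m n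

theorem apply_mul_le (h : SubadditiveOnOrbit T f x) (t k : ℕ) :
    f (t * k) x ≤ birkhoffSum T^[t] (f t) k x := by
  induction k with
  | zero => simp [h.apply_zero]
  | succ k ih =>
    rw [birkhoffSum_succ, mul_add_one, ← Function.iterate_mul]
    exact (h.apply_add_le _ _).trans (by gcongr)

theorem le_birkhoffSum (h : SubadditiveOnOrbit T f x) (n : ℕ) :
    f n x ≤ birkhoffSum T (f 1) n x := by
  simpa using h.apply_mul_le 1 n

theorem birkhoffSum_mul_le (h : SubadditiveOnOrbit T f x) (t m k : ℕ) :
    birkhoffSum T^[t * m] (f (t * m)) k x ≤ birkhoffSum T^[t] (f t) (m * k) x := by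
  induction k with
  | zero => simp
  | succ k ih =>
    rw [birkhoffSum_succ, mul_add_one, birkhoffSum_add, ← Function.iterate_mul,
      ← Function.iterate_mul, mul_assoc]
    exact add_le_add ih ((h.iterate _).apply_mul_le t m)

/-- Division with remainder: `n / t` blocks of length `t`, then at most `t - 1` single steps. -/
theorem le_birkhoffSum_blocks_add (h : SubadditiveOnOrbit T f x) (t n : ℕ) :
    f n x ≤ birkhoffSum T^[t] (f t) (n / t) x +
      (birkhoffSum T (f 1) n x - birkhoffSum T (f 1) (t * (n / t)) x) := by
  have hrest : birkhoffSum T (f 1) n x = birkhoffSum T (f 1) (t * (n / t)) x +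
      birkhoffSum T (f 1) (n % t) (T^[t * (n / t)] x) := by
    rw [← birkhoffSum_add, Nat.div_add_mod]
  calc f n x = f (t * (n / t) + n % t) x := by rw [Nat.div_add_mod]
    _ ≤ f (t * (n / t)) x + f (n % t) (T^[t * (n / t)] x) := h.apply_add_le _ _
    _ ≤ birkhoffSum T^[t] (f t) (n / t) x +
        birkhoffSum T (f 1) (n % t) (T^[t * (n / t)] x) :=
      add_le_add (h.apply_mul_le _ _) ((h.iterate _).le_birkhoffSum _)
    _ = _ := by rw [hrest]; ring

/-- Starting from `x`, jump repeatedly by a length `l` that `hcover` provides; when the next jump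
would leave `[0, n)`, fewer than `N` points remain, and single steps cover them. -/
theorem le_birkhoffSum_add_sum_Ico (h : SubadditiveOnOrbit T f x) (hψ : ∀ y, 0 ≤ ψ y)
    (hcover : ∀ i, ∃ l, 1 ≤ l ∧ l ≤ N ∧ f l (T^[i] x) ≤ birkhoffSum T ψ l (T^[i] x)) (n : ℕ) :
    f n x ≤ birkhoffSum T ψ n x + ∑ i ∈ Finset.Ico (n - N) n, max (f 1 (T^[i] x)) 0 := by
  induction n using Nat.strong_induction_on generalizing x with
  | _ n ih =>
    obtain ⟨l, hl, hlN, hlf⟩ := hcover 0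
    rw [Function.iterate_zero_apply] at hlf
    rcases le_or_gt l n with hln | hnl
    · obtain ⟨m, rfl⟩ := Nat.exists_eq_add_of_le hln
      have hrest := ih m (by omega) (h.iterate l) fun i => by
        simpa only [← Function.iterate_add_apply] using hcover (i + l)
      have hshift : ∑ i ∈ Finset.Ico (m - N) m, max (f 1 (T^[i] (T^[l] x))) 0 ≤
          ∑ i ∈ Finset.Ico (l + m - N) (l + m), max (f 1 (T^[i] x)) 0 := by
        simp_rw [← Function.iterate_add_apply]
        rw [Finset.sum_Ico_add' (fun i => max (f 1 (T^[i] x)) 0)]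
        refine Finset.sum_le_sum_of_subset_of_nonneg ?_ fun i _ _ => le_max_right _ _
        exact Finset.Ico_subset_Ico (by omega) (by omega)
      rw [birkhoffSum_add]
      linarith [h.apply_add_le l m]
    · have hψn : 0 ≤ birkhoffSum T ψ n x := Finset.sum_nonneg fun i _ => hψ _
      rw [show n - N = 0 by omega, ← Finset.range_eq_Ico]
      calc f n x ≤ birkhoffSum T (f 1) n x := h.le_birkhoffSum n
        _ ≤ ∑ i ∈ Finset.range n, max (f 1 (T^[i] x)) 0 :=
          Finset.sum_le_sum fun i _ => le_max_left _ _
        _ ≤ _ := le_add_of_nonneg_left hψn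

end SubadditiveOnOrbit

/-- The positive part of `f 1`, restricted to the points `x` at which none of
`f 1 x, …, f N x` is nonpositive. It tends to `0` as `N → ∞`
where some `f n` with `n ≥ 1` is nonpositive. -/
noncomputable def uncoveredPart (f : ℕ → α → ℝ) (N : ℕ) : α → ℝ :=
  {x | ∀ l ∈ Finset.Icc 1 N, 0 < f l x}.indicator fun x => max (f 1 x) 0

theorem uncoveredPart_nonneg (f : ℕ → α → ℝ) (N : ℕ) (x : α) : 0 ≤ uncoveredPart f N x :=
  Set.indicator_nonneg (fun _ _ => le_max_right _ _) x

theorem exists_le_birkhoffSum_uncoveredPart (T : α → α) (f : ℕ → α → ℝ) {N : ℕ} (hN : 1 ≤ N)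
    (x : α) : ∃ l, 1 ≤ l ∧ l ≤ N ∧ f l x ≤ birkhoffSum T (uncoveredPart f N) l x := by
  by_cases hx : ∀ l ∈ Finset.Icc 1 N, 0 < f l x
  · refine ⟨1, le_rfl, hN, ?_⟩
    rw [birkhoffSum_one, uncoveredPart, Set.indicator_of_mem (by exact hx)]
    exact le_max_left _ _
  · push Not at hx
    obtain ⟨l, hl, hfl⟩ := hx
    obtain ⟨hl1, hlN⟩ := Finset.mem_Icc.1 hl
    exact ⟨l, hl1, hlN, hfl.trans (Finset.sum_nonneg fun _ _ => uncoveredPart_nonneg _ _ _)⟩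

end Orbit

/-! ### The lower bound and Birkhoff's theorem -/

section Cocycle

variable {α : Type*} {m m₀ : MeasurableSpace α} {μ : Measure α} {T : α → α} {f : ℕ → α → ℝ}
  {g Φ : α → ℝ}

section MeasurePreserving

theorem ae_forall_iterate_of_ae (hT : MeasurePreserving T μ μ) {p : α → Prop}
    (hp : ∀ᵐ x ∂μ, p x) : ∀ᵐ x ∂μ, ∀ i : ℕ, p (T^[i] x) :=
  ae_all_iff.2 fun i => (hT.iterate i).quasiMeasurePreserving.ae hp

theorem integral_comp_of_measurePreserving (hT : MeasurePreserving T μ μ)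
    (hg : AEStronglyMeasurable g μ) : ∫ x, g (T x) ∂μ = ∫ x, g x ∂μ := by
  rw [← integral_map hT.measurable.aemeasurable (by rwa [hT.map_eq]), hT.map_eq]

theorem measurePreserving_restrict_of_measurableSet_invariants (hT : MeasurePreserving T μ μ)
    {s : Set α} (hs : MeasurableSet[MeasurableSpace.invariants T] s) :
    MeasurePreserving T (μ.restrict s) (μ.restrict s) := by
  obtain ⟨hsm, hTs⟩ := MeasurableSpace.measurableSet_invariants.1 hs
  simpa only [hTs] using hT.restrict_preimage hsm

theorem integrable_birkhoffSum (hT : MeasurePreserving T μ μ) (hg : Integrable g μ) (n : ℕ) :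
    Integrable (birkhoffSum T g n) μ :=
  integrable_finsetSum _ fun i _ => (hT.iterate i).integrable_comp_of_integrable hg

theorem integral_birkhoffSum (hT : MeasurePreserving T μ μ) (hg : Integrable g μ) (n : ℕ) :
    ∫ x, birkhoffSum T g n x ∂μ = n * ∫ x, g x ∂μ := by
  simp only [birkhoffSum]
  rw [integral_finsetSum (f := fun i x => g (T^[i] x)) _
    fun i _ => (hT.iterate i).integrable_comp_of_integrable hg]
  simp [integral_comp_of_measurePreserving (hT.iterate _) hg.aestronglyMeasurable]

theorem condExp_comp [IsFiniteMeasure μ] (hT : MeasurePreserving T μ μ) (hg : Integrable g μ)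
    (hm : m ≤ MeasurableSpace.invariants T) :
    μ[g ∘ T|m] =ᵐ[μ] μ[g|m] := by
  have hm₀ := hm.trans (MeasurableSpace.invariants_le T)
  refine (ae_eq_condExp_of_forall_setIntegral_eq hm₀ (hT.integrable_comp_of_integrable hg)
    (fun s _ _ => integrable_condExp.integrableOn) (fun s hs _ => ?_)
    stronglyMeasurable_condExp.aestronglyMeasurable).symm
  rw [setIntegral_condExp hm₀ hg hs]
  exact (integral_comp_of_measurePreserving
    (measurePreserving_restrict_of_measurableSet_invariants hT (hm s hs))
    hg.aestronglyMeasurable.restrict).symm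

theorem condExp_comp_iterate [IsFiniteMeasure μ] (hT : MeasurePreserving T μ μ)
    (hg : Integrable g μ) (n : ℕ) :
    μ[g ∘ T^[n]|MeasurableSpace.invariants T] =ᵐ[μ] μ[g|MeasurableSpace.invariants T] :=
  condExp_comp (hT.iterate n) hg (MeasurableSpace.le_invariants_iterate T n)

theorem condExp_birkhoffSum [IsFiniteMeasure μ] (hT : MeasurePreserving T μ μ)
    (hg : Integrable g μ) (n : ℕ) :
    ∀ᵐ x ∂μ, (μ[birkhoffSum T g n|MeasurableSpace.invariants T]) x =
      n * (μ[g|MeasurableSpace.invariants T]) x := by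
  have hsum : birkhoffSum T g n = ∑ i ∈ Finset.range n, g ∘ T^[i] := by
    ext x; simp [birkhoffSum]
  rw [hsum]
  filter_upwards [condExp_finsetSum (s := Finset.range n)
      (fun i _ => (hT.iterate i).integrable_comp_of_integrable hg) (MeasurableSpace.invariants T),
    ae_all_iff.2 fun i => condExp_comp_iterate hT hg i] with x hx hi
  simp [hx, hi]

end MeasurePreserving

/-- A subadditive cocycle in the sense of Kingman: a sequence of integrable functions with
`f (m + n) ≤ f m + f n ∘ T^[m]` almost everywhere, normalised by `f 0 = 0`. -/
structure IsSubadditiveCocycle (f : ℕ → α → ℝ) (T : α → α) (μ : Measure α) : Prop where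
  zero : f 0 = 0
  integrable : ∀ n, Integrable (f n) μ
  add_le : ∀ m n, ∀ᵐ x ∂μ, f (m + n) x ≤ f m x + f n (T^[m] x)

theorem isSubadditiveCocycle_birkhoffSum (hT : MeasurePreserving T μ μ) (hg : Integrable g μ) :
    IsSubadditiveCocycle (birkhoffSum T g) T μ where
  zero := birkhoffSum_zero' T g
  integrable := integrable_birkhoffSum hT hg
  add_le m n := ae_of_all _ fun x => (birkhoffSum_add T g m n x).le

namespace IsSubadditiveCocycle

theorem ae_subadditiveOnOrbit (hf : IsSubadditiveCocycle f T μ) (hT : MeasurePreserving T μ μ) :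
    ∀ᵐ x ∂μ, SubadditiveOnOrbit T f x := by
  filter_upwards [ae_forall_iterate_of_ae hT
    (ae_all_iff.2 fun m => ae_all_iff.2 fun n => hf.add_le m n)] with x hx
  exact ⟨fun i => congrFun hf.zero _, hx⟩

theorem restrict (hf : IsSubadditiveCocycle f T μ) (s : Set α) :
    IsSubadditiveCocycle f T (μ.restrict s) where
  zero := hf.zero
  integrable n := (hf.integrable n).restrict
  add_le m n := ae_restrict_of_ae (hf.add_le m n)

theorem sub_mul (hf : IsSubadditiveCocycle f T μ) (hΦ : Integrable Φ μ) (hΦT : Φ ∘ T = Φ) :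
    IsSubadditiveCocycle (fun n x => f n x - n * Φ x) T μ where
  zero := by ext x; simp [hf.zero]
  integrable n := (hf.integrable n).sub (hΦ.const_mul _)
  add_le m n := by
    have hΦm : Φ ∘ T^[m] = Φ := Function.iterate_invariant hΦT m
    filter_upwards [hf.add_le m n] with x hx
    rw [show Φ (T^[m] x) = Φ x from congrFun hΦm x]
    push_cast
    linarith

theorem integrable_uncoveredPart (hf : IsSubadditiveCocycle f T μ) (N : ℕ) :
    Integrable (uncoveredPart f N) μ := by
  refine ((hf.integrable 1).pos_part).indicator₀ ?_
  simp only [Set.ofPred_forall]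
  exact .iInter fun l => .iInter fun _ =>
    nullMeasurableSet_lt aemeasurable_const (hf.integrable l).aemeasurable

theorem tendsto_integral_uncoveredPart (hf : IsSubadditiveCocycle f T μ)
    (hneg : ∀ᵐ x ∂μ, ∃ n, 1 ≤ n ∧ f n x ≤ 0) :
    Tendsto (fun N => ∫ x, uncoveredPart f N x ∂μ) atTop (𝓝 0) := by
  rw [← integral_zero α ℝ (μ := μ)]
  refine tendsto_integral_of_dominated_convergence (fun x => max (f 1 x) 0)
    (fun N => (hf.integrable_uncoveredPart N).aestronglyMeasurable) (hf.integrable 1).pos_part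
    (fun N => ae_of_all _ fun x => ?_) ?_
  · rw [Real.norm_of_nonneg (uncoveredPart_nonneg f N x)]
    exact Set.indicator_le_self' (fun _ _ => le_max_right _ _) x
  · filter_upwards [hneg] with x ⟨n, hn, hfn⟩
    refine tendsto_const_nhds.congr' ?_
    filter_upwards [eventually_ge_atTop n] with N hN
    refine (Set.indicator_of_notMem (fun hx => ?_) _).symm
    exact hfn.not_gt (hx n (Finset.mem_Icc.2 ⟨hn, hN⟩))

theorem integral_le_add_uncoveredPart (hf : IsSubadditiveCocycle f T μ)
    (hT : MeasurePreserving T μ μ) {N : ℕ} (hN : 1 ≤ N) (n : ℕ) :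
    ∫ x, f n x ∂μ ≤ n * ∫ x, uncoveredPart f N x ∂μ + N * ∫ x, max (f 1 x) 0 ∂μ := by
  have hpos : Integrable (fun x => max (f 1 x) 0) μ := (hf.integrable 1).pos_part
  have hpos_comp (i : ℕ) : Integrable (fun x => max (f 1 (T^[i] x)) 0) μ :=
    (hT.iterate i).integrable_comp_of_integrable hpos
  have hψ := integrable_birkhoffSum hT (hf.integrable_uncoveredPart N) n
  calc ∫ x, f n x ∂μ
      ≤ ∫ x, (birkhoffSum T (uncoveredPart f N) n x +
          ∑ i ∈ Finset.Ico (n - N) n, max (f 1 (T^[i] x)) 0) ∂μ := by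
        refine integral_mono_ae (hf.integrable n)
          (hψ.add (integrable_finsetSum _ fun i _ => hpos_comp i)) ?_
        filter_upwards [hf.ae_subadditiveOnOrbit hT] with x hx
        exact hx.le_birkhoffSum_add_sum_Ico (uncoveredPart_nonneg f N)
          (fun i => exists_le_birkhoffSum_uncoveredPart T f hN _) n
    _ = n * ∫ x, uncoveredPart f N x ∂μ + (n - (n - N) : ℕ) * ∫ x, max (f 1 x) 0 ∂μ := by
        rw [integral_add hψ (integrable_finsetSum _ fun i _ => hpos_comp i),
          integral_birkhoffSum hT (hf.integrable_uncoveredPart N),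
          integral_finsetSum _ fun i _ => hpos_comp i]
        simp [integral_comp_of_measurePreserving (g := fun x => max (f 1 x) 0) (hT.iterate _)
          hpos.aestronglyMeasurable]
    _ ≤ _ := by
        have : 0 ≤ ∫ x, max (f 1 x) 0 ∂μ := integral_nonneg fun x => le_max_right _ _
        gcongr
        omega

theorem nonpos_of_forall_mul_le_integral (hf : IsSubadditiveCocycle f T μ)
    (hT : MeasurePreserving T μ μ) (hneg : ∀ᵐ x ∂μ, ∃ n, 1 ≤ n ∧ f n x ≤ 0) {γ : ℝ}
    (hγ : ∀ n : ℕ, n * γ ≤ ∫ x, f n x ∂μ) : γ ≤ 0 := by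
  refine ge_of_tendsto (hf.tendsto_integral_uncoveredPart hneg) ?_
  filter_upwards [eventually_ge_atTop 1] with N hN
  have hlim : Tendsto (fun n : ℕ => ∫ x, uncoveredPart f N x ∂μ +
      N * (∫ x, max (f 1 x) 0 ∂μ) / n) atTop (𝓝 (∫ x, uncoveredPart f N x ∂μ + 0)) :=
    tendsto_const_nhds.add (tendsto_const_div_atTop_nhds_zero_nat _)
  rw [add_zero] at hlim
  refine ge_of_tendsto hlim ?_
  filter_upwards [eventually_gt_atTop 0] with n hn
  have hn' : (0 : ℝ) < n := Nat.cast_pos.2 hn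
  refine le_of_mul_le_mul_left ?_ hn'
  rw [mul_add, mul_div_cancel₀ _ hn'.ne']
  exact (hγ n).trans (hf.integral_le_add_uncoveredPart hT hN n)

theorem nullMeasurableSet_not_bddBelow (hf : IsSubadditiveCocycle f T μ) :
    NullMeasurableSet {x | ¬ BddBelow (Set.range fun n => f n x)} μ := by
  refine (measurableSet_bddBelow_range fun n =>
    (hf.integrable n).aemeasurable.measurable_mk).compl.nullMeasurableSet.congr ?_
  filter_upwards [ae_all_iff.2 fun n => (hf.integrable n).aemeasurable.ae_eq_mk] with x hx
  exact congrArg (fun u : ℕ → ℝ => ¬ BddBelow (Set.range u)) (funext fun n => (hx n).symm)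

theorem preimage_not_bddBelow_ae_eq [IsFiniteMeasure μ] (hf : IsSubadditiveCocycle f T μ)
    (hT : MeasurePreserving T μ μ) :
    T ⁻¹' {x | ¬ BddBelow (Set.range fun n => f n x)} =ᵐ[μ]
      {x | ¬ BddBelow (Set.range fun n => f n x)} := by
  have hA := hf.nullMeasurableSet_not_bddBelow
  refine ae_eq_of_ae_subset_of_measure_ge ?_ (hT.measure_preimage hA).ge
    (hA.preimage hT.quasiMeasurePreserving) (measure_ne_top _ _)
  filter_upwards [hf.ae_subadditiveOnOrbit hT] with x hx hTx
  refine fun ⟨a, ha⟩ => hTx ⟨a - f 1 x, Set.forall_mem_range.2 fun n => ?_⟩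
  have := hx.apply_add_le 1 n
  rw [Function.iterate_one] at this
  linarith [ha ⟨1 + n, rfl⟩]

/-- The set where the cocycle is unbounded below is invariant, and the cocycle takes nonpositive
values on it, which its growth in mean forbids unless the set is null. -/
theorem ae_bddBelow [IsFiniteMeasure μ] (hf : IsSubadditiveCocycle f T μ)
    (hT : MeasurePreserving T μ μ) {ε : ℝ} (hε : 0 < ε)
    (hgrowth : ∀ n : ℕ, ∀ᵐ x ∂μ, n * ε ≤ (μ[f n|MeasurableSpace.invariants T]) x) :
    ∀ᵐ x ∂μ, BddBelow (Set.range fun n => f n x) := by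
  obtain ⟨s, hsm, hsA, hTs⟩ := hT.quasiMeasurePreserving.exists_preimage_eq_of_preimage_ae
    hf.nullMeasurableSet_not_bddBelow (hf.preimage_not_bddBelow_ae_eq hT)
  have hs : MeasurableSet[MeasurableSpace.invariants T] s :=
    MeasurableSpace.measurableSet_invariants.2 ⟨hsm, hTs⟩
  have hneg : ∀ᵐ x ∂μ.restrict s, ∃ n, 1 ≤ n ∧ f n x ≤ 0 := by
    filter_upwards [ae_restrict_mem hsm, ae_restrict_of_ae hsA.mem_iff] with x hxs hxA
    by_contra! hpos
    refine hxA.1 hxs ⟨0, Set.forall_mem_range.2 fun n => ?_⟩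
    rcases Nat.eq_zero_or_pos n with rfl | hn
    · simp [hf.zero]
    · exact (hpos n hn).le
  have hmean : μ.real s * ε ≤ 0 := by
    refine (hf.restrict s).nonpos_of_forall_mul_le_integral
      (measurePreserving_restrict_of_measurableSet_invariants hT hs) hneg fun n => ?_
    calc (n : ℝ) * (μ.real s * ε) = ∫ _ in s, n * ε ∂μ := by
          rw [setIntegral_const, smul_eq_mul]; ring
      _ ≤ ∫ x in s, (μ[f n|MeasurableSpace.invariants T]) x ∂μ :=
        integral_mono_ae (integrable_const _) integrable_condExp.integrableOn
          (ae_restrict_of_ae (hgrowth n))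
      _ = ∫ x in s, f n x ∂μ :=
        setIntegral_condExp (MeasurableSpace.invariants_le T) (hf.integrable n) hs
  have hμs : μ s = 0 := by
    rw [← measureReal_eq_zero_iff]
    exact le_antisymm (nonpos_of_mul_nonpos_left hmean hε) measureReal_nonneg
  rw [← measure_congr hsA.symm] at hμs
  exact ae_iff.2 hμs

/-- `ae_bddBelow` applies to `f n - n * (Φ - ε)`, whose conditional means are at least `n * ε`. -/
theorem ae_eventually_lt_div [IsFiniteMeasure μ] (hf : IsSubadditiveCocycle f T μ)
    (hT : MeasurePreserving T μ μ) (hΦ : Integrable Φ μ)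
    (hΦm : StronglyMeasurable[MeasurableSpace.invariants T] Φ)
    (hle : ∀ n : ℕ, ∀ᵐ x ∂μ, n * Φ x ≤ (μ[f n|MeasurableSpace.invariants T]) x) :
    ∀ᵐ x ∂μ, ∀ a < Φ x, ∀ᶠ n : ℕ in atTop, a < f n x / n := by
  have hbdd (ε : ℝ) (hε : 0 < ε) :
      ∀ᵐ x ∂μ, BddBelow (Set.range fun n : ℕ => f n x - n * (Φ x - ε)) := by
    have hΦε : Integrable (fun x => Φ x - ε) μ := hΦ.sub (integrable_const ε)
    have hΦεm : StronglyMeasurable[MeasurableSpace.invariants T] fun x => Φ x - ε :=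
      hΦm.sub stronglyMeasurable_const
    refine (hf.sub_mul hΦε
      (MeasurableSpace.comp_eq_of_measurable_invariants hΦεm.measurable)).ae_bddBelow hT hε
      fun n => ?_
    filter_upwards [hle n, condExp_sub (hf.integrable n) (hΦε.const_mul (n : ℝ))
      (MeasurableSpace.invariants T)] with x hx hsub
    rw [condExp_of_stronglyMeasurable (MeasurableSpace.invariants_le T) (hΦεm.const_mul _)
      (hΦε.const_mul _)] at hsub
    change _ ≤ (μ[f n - (fun x => n * (Φ x - ε))|MeasurableSpace.invariants T]) x
    rw [hsub, Pi.sub_apply]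
    linarith
  filter_upwards [ae_all_iff.2 fun k : ℕ => hbdd (1 / (k + 1)) Nat.one_div_pos_of_nat]
    with x hx a ha
  obtain ⟨k, hk⟩ := exists_nat_one_div_lt (sub_pos.2 ha)
  obtain ⟨C, hC⟩ := hx k
  have hlim : Tendsto (fun n : ℕ => Φ x - 1 / (k + 1) + C / n) atTop (𝓝 (Φ x - 1 / (k + 1) + 0)) :=
    tendsto_const_nhds.add (tendsto_const_div_atTop_nhds_zero_nat C)
  filter_upwards [hlim.eventually_const_lt (u := a) (by linarith), eventually_gt_atTop 0]
    with n hn hn0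
  have hn' : (0 : ℝ) < n := Nat.cast_pos.2 hn0
  have hCn : C ≤ f n x - n * (Φ x - 1 / (k + 1)) := hC ⟨n, rfl⟩
  refine hn.trans_le ((le_div_iff₀ hn').2 ?_)
  rw [add_mul, div_mul_cancel₀ _ hn'.ne']
  linarith

end IsSubadditiveCocycle

theorem ae_tendsto_birkhoffSum_div [IsFiniteMeasure μ] (hT : MeasurePreserving T μ μ)
    (hg : Integrable g μ) :
    ∀ᵐ x ∂μ, Tendsto (fun n : ℕ => birkhoffSum T g n x / n) atTop
      (𝓝 ((μ[g|MeasurableSpace.invariants T]) x)) := by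
  have hlower {g : α → ℝ} (hg : Integrable g μ) :
      ∀ᵐ x ∂μ, ∀ a < (μ[g|MeasurableSpace.invariants T]) x,
        ∀ᶠ n : ℕ in atTop, a < birkhoffSum T g n x / n := by
    refine (isSubadditiveCocycle_birkhoffSum hT hg).ae_eventually_lt_div hT integrable_condExp
      stronglyMeasurable_condExp fun n => ?_
    filter_upwards [condExp_birkhoffSum hT hg n] with x hx using hx.ge
  filter_upwards [hlower hg, hlower hg.neg, condExp_neg g (MeasurableSpace.invariants T)]
    with x hx hneg hx'
  refine tendsto_order.2 ⟨hx, fun a ha => ?_⟩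
  rw [hx', Pi.neg_apply] at hneg
  filter_upwards [hneg (-a) (neg_lt_neg ha)] with n hn
  rw [birkhoffSum_neg, neg_div] at hn
  exact neg_lt_neg_iff.1 hn

/-! ### Conditional means -/

theorem exists_eLpNorm_one_le_of_antitone {w : ℕ → α → ℝ} (hw : ∀ n, Integrable (w n) μ)
    (hanti : ∀ᵐ x ∂μ, Antitone fun n => w n x)
    (hbdd : BddBelow (Set.range fun n => ∫ x, w n x ∂μ)) :
    ∃ R : NNReal, ∀ n, eLpNorm (w n) 1 μ ≤ R := by
  obtain ⟨c, hc⟩ := hbdd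
  refine ⟨(∫ x, (‖w 0 x‖ + w 0 x) ∂μ - c).toNNReal, fun n => ?_⟩
  rw [eLpNorm_one_eq_lintegral_enorm, ← ofReal_integral_norm_eq_lintegral_enorm (hw n)]
  refine ENNReal.ofReal_le_ofReal ?_
  calc ∫ x, ‖w n x‖ ∂μ ≤ ∫ x, (‖w 0 x‖ + w 0 x - w n x) ∂μ := by
        refine integral_mono_ae (hw n).norm (((hw 0).norm.add (hw 0)).sub (hw n)) ?_
        filter_upwards [hanti] with x hx
        have hn := hx (Nat.zero_le n)
        simp only [Real.norm_eq_abs] at hn ⊢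
        exact abs_le'.2 ⟨by linarith [le_abs_self (w 0 x)], by linarith [neg_abs_le (w 0 x)]⟩
    _ = ∫ x, (‖w 0 x‖ + w 0 x) ∂μ - ∫ x, w n x ∂μ := integral_sub ((hw 0).norm.add (hw 0)) (hw n)
    _ ≤ _ := sub_le_sub_left (hc ⟨n, rfl⟩) _

theorem ae_bddBelow_range_of_antitone {w : ℕ → α → ℝ} (hw : ∀ n, Integrable (w n) μ)
    (hanti : ∀ᵐ x ∂μ, Antitone fun n => w n x)
    (hbdd : BddBelow (Set.range fun n => ∫ x, w n x ∂μ)) :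
    ∀ᵐ x ∂μ, BddBelow (Set.range fun n => w n x) := by
  obtain ⟨R, hR⟩ := exists_eLpNorm_one_le_of_antitone hw hanti hbdd
  have hmk (n : ℕ) := (hw n).aemeasurable.ae_eq_mk
  have hliminf := ae_bdd_liminf_atTop_of_eLpNorm_bdd one_ne_zero
    (fun n => (hw n).aemeasurable.measurable_mk)
    (fun n => (eLpNorm_congr_ae (hmk n)).symm.trans_le (hR n))
  filter_upwards [hliminf, hanti, ae_all_iff.2 hmk] with x hx hxanti hxmk
  simp only [← hxmk] at hx
  obtain ⟨C, hxC, hC⟩ := exists_between hx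
  have hfreq : ∃ᶠ n in atTop, ‖w n x‖ₑ < C := frequently_lt_of_liminf_lt (by isBoundedDefault) hxC
  refine ⟨-C.toReal, Set.forall_mem_range.2 fun n => ?_⟩
  obtain ⟨k, hnk, hk⟩ := frequently_atTop.1 hfreq n
  have hkC : ‖w k x‖ ≤ C.toReal := by
    rw [← toReal_enorm]
    exact ENNReal.toReal_mono hC.ne hk.le
  exact (abs_le.1 hkC).1.trans (hxanti hnk)

theorem bddBelow_range_div_of_frequently_le {u : ℕ → ℝ} (hu : Subadditive u) {C : ℝ}
    (hC : ∃ᶠ n : ℕ in atTop, C ≤ u n / n) : BddBelow (Set.range fun n : ℕ => u n / n) := by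
  refine ⟨min C 0, Set.forall_mem_range.2 fun n => ?_⟩
  rcases Nat.eq_zero_or_pos n with rfl | hn
  · simp
  · by_contra! hlt
    exact hC ((hu.eventually_div_lt_of_div_lt hn.ne' (hlt.trans_le (min_le_left _ _))).mono
      fun _ h => h.not_ge)

theorem antitone_two_pow_div_of_subadditive {u : ℕ → ℝ} (hu : Subadditive u) :
    Antitone fun l : ℕ => u (2 ^ l) / (2 ^ l : ℕ) := by
  refine antitone_nat_of_succ_le fun l => ?_
  rw [div_le_div_iff₀ (by positivity) (by positivity)]
  calc u (2 ^ (l + 1)) * (2 ^ l : ℕ) ≤ (u (2 ^ l) + u (2 ^ l)) * (2 ^ l : ℕ) := by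
        gcongr
        simpa only [← two_mul, ← pow_succ'] using hu (2 ^ l) (2 ^ l)
    _ = u (2 ^ l) * (2 ^ (l + 1) : ℕ) := by push_cast; ring

/-- The almost everywhere limit of `f n / n` in Kingman's theorem, as the limit that Fekete's lemma
gives for the conditional means of `f n`. The infimum is over `n ≥ 1` and has the junk value `0`
where it would be `-∞`. -/
noncomputable def condGrowthRate (μ : Measure α) (T : α → α) (f : ℕ → α → ℝ) (x : α) : ℝ :=
  sInf ((fun n : ℕ => (μ[f n|MeasurableSpace.invariants T]) x / n) '' Set.Ici 1)

theorem stronglyMeasurable_condGrowthRate :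
    StronglyMeasurable[MeasurableSpace.invariants T] (condGrowthRate μ T f) := by
  refine Measurable.stronglyMeasurable ?_
  unfold condGrowthRate
  simp only [sInf_image']
  exact Measurable.iInf fun n => stronglyMeasurable_condExp.measurable.div_const _

theorem condGrowthRate_iterate (n : ℕ) (x : α) :
    condGrowthRate μ T f (T^[n] x) = condGrowthRate μ T f x :=
  congrFun (Function.iterate_invariant (MeasurableSpace.comp_eq_of_measurable_invariants
    stronglyMeasurable_condGrowthRate.measurable) n) x

theorem integral_condExp_div [IsFiniteMeasure μ] (n : ℕ) :
    ∫ x, (μ[f n|MeasurableSpace.invariants T]) x / n ∂μ = (∫ x, f n x ∂μ) / n := by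
  rw [integral_div, integral_condExp (MeasurableSpace.invariants_le T)]

theorem bddBelow_range_integral_condExp_two_pow_div [IsFiniteMeasure μ]
    (hbdd : BddBelow (Set.range fun n : ℕ => (∫ x, f n x ∂μ) / n)) :
    BddBelow (Set.range fun l : ℕ =>
      ∫ x, (μ[f (2 ^ l)|MeasurableSpace.invariants T]) x / (2 ^ l : ℕ) ∂μ) := by
  simp only [integral_condExp_div]
  exact hbdd.mono (Set.range_comp_subset_range (2 ^ ·) fun n : ℕ => (∫ x, f n x ∂μ) / n)

namespace IsSubadditiveCocycle

theorem subadditive_integral (hf : IsSubadditiveCocycle f T μ) (hT : MeasurePreserving T μ μ) :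
    Subadditive fun n => ∫ x, f n x ∂μ := fun m n =>
  have hcomp : Integrable (fun x => f n (T^[m] x)) μ :=
    (hT.iterate m).integrable_comp_of_integrable (hf.integrable n)
  calc ∫ x, f (m + n) x ∂μ ≤ ∫ x, (f m x + f n (T^[m] x)) ∂μ :=
        integral_mono_ae (hf.integrable _) ((hf.integrable m).add hcomp) (hf.add_le m n)
    _ = ∫ x, f m x ∂μ + ∫ x, f n x ∂μ := by
        rw [integral_add (hf.integrable m) hcomp, integral_comp_of_measurePreserving (hT.iterate m)
          (hf.integrable n).aestronglyMeasurable]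

variable [IsFiniteMeasure μ]

theorem ae_subadditive_condExp (hf : IsSubadditiveCocycle f T μ) (hT : MeasurePreserving T μ μ) :
    ∀ᵐ x ∂μ, Subadditive fun n => (μ[f n|MeasurableSpace.invariants T]) x := by
  refine ae_all_iff.2 fun m => ae_all_iff.2 fun n => ?_
  have hcomp := (hT.iterate m).integrable_comp_of_integrable (hf.integrable n)
  filter_upwards [condExp_mono (m := MeasurableSpace.invariants T) (hf.integrable (m + n))
      ((hf.integrable m).add hcomp) (hf.add_le m n),
    condExp_add (hf.integrable m) hcomp (MeasurableSpace.invariants T),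
    condExp_comp_iterate hT (hf.integrable n) m] with x hle hadd hinv
  rwa [hadd, Pi.add_apply, hinv] at hle

theorem ae_antitone_condExp_two_pow_div (hf : IsSubadditiveCocycle f T μ)
    (hT : MeasurePreserving T μ μ) :
    ∀ᵐ x ∂μ, Antitone fun l : ℕ =>
      (μ[f (2 ^ l)|MeasurableSpace.invariants T]) x / (2 ^ l : ℕ) := by
  filter_upwards [hf.ae_subadditive_condExp hT] with x hx
  exact antitone_two_pow_div_of_subadditive hx

theorem ae_bddBelow_condExp_div (hf : IsSubadditiveCocycle f T μ) (hT : MeasurePreserving T μ μ)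
    (hbdd : BddBelow (Set.range fun n : ℕ => (∫ x, f n x ∂μ) / n)) :
    ∀ᵐ x ∂μ, BddBelow (Set.range fun n : ℕ => (μ[f n|MeasurableSpace.invariants T]) x / n) := by
  filter_upwards [hf.ae_subadditive_condExp hT, ae_bddBelow_range_of_antitone
    (fun l => integrable_condExp.div_const _) (hf.ae_antitone_condExp_two_pow_div hT)
    (bddBelow_range_integral_condExp_two_pow_div hbdd)] with x hsub ⟨C, hC⟩
  refine bddBelow_range_div_of_frequently_le hsub (C := C) ?_
  exact frequently_atTop.2 fun n => ⟨2 ^ n, Nat.lt_two_pow_self.le, hC ⟨n, rfl⟩⟩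

theorem ae_mul_condGrowthRate_le (hf : IsSubadditiveCocycle f T μ) (hT : MeasurePreserving T μ μ)
    (hbdd : BddBelow (Set.range fun n : ℕ => (∫ x, f n x ∂μ) / n)) (n : ℕ) :
    ∀ᵐ x ∂μ, n * condGrowthRate μ T f x ≤ (μ[f n|MeasurableSpace.invariants T]) x := by
  rcases Nat.eq_zero_or_pos n with rfl | hn
  · rw [hf.zero, condExp_zero]
    simp
  · filter_upwards [hf.ae_bddBelow_condExp_div hT hbdd] with x hx
    rw [← le_div_iff₀' (by positivity)]
    exact csInf_le (hx.mono (Set.image_subset_range _ _)) ⟨n, hn, rfl⟩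

theorem ae_tendsto_condExp_div (hf : IsSubadditiveCocycle f T μ) (hT : MeasurePreserving T μ μ)
    (hbdd : BddBelow (Set.range fun n : ℕ => (∫ x, f n x ∂μ) / n)) :
    ∀ᵐ x ∂μ, Tendsto (fun n : ℕ => (μ[f n|MeasurableSpace.invariants T]) x / n) atTop
      (𝓝 (condGrowthRate μ T f x)) := by
  filter_upwards [hf.ae_subadditive_condExp hT, hf.ae_bddBelow_condExp_div hT hbdd] with x hsub hx
  have hlim := hsub.tendsto_lim hx
  rwa [Subadditive.lim] at hlim

theorem ae_tendsto_condExp_two_pow_div (hf : IsSubadditiveCocycle f T μ)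
    (hT : MeasurePreserving T μ μ)
    (hbdd : BddBelow (Set.range fun n : ℕ => (∫ x, f n x ∂μ) / n)) :
    ∀ᵐ x ∂μ, Tendsto (fun l : ℕ =>
      (μ[f (2 ^ l)|MeasurableSpace.invariants T]) x / (2 ^ l : ℕ)) atTop
      (𝓝 (condGrowthRate μ T f x)) := by
  filter_upwards [hf.ae_tendsto_condExp_div hT hbdd] with x hx
  exact hx.comp (tendsto_pow_atTop_atTop_of_one_lt one_lt_two)

theorem integrable_condGrowthRate (hf : IsSubadditiveCocycle f T μ) (hT : MeasurePreserving T μ μ)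
    (hbdd : BddBelow (Set.range fun n : ℕ => (∫ x, f n x ∂μ) / n)) :
    Integrable (condGrowthRate μ T f) μ := by
  have hw (l : ℕ) : Integrable
      (fun x => (μ[f (2 ^ l)|MeasurableSpace.invariants T]) x / (2 ^ l : ℕ)) μ :=
    integrable_condExp.div_const _
  obtain ⟨R, hR⟩ := exists_eLpNorm_one_le_of_antitone hw (hf.ae_antitone_condExp_two_pow_div hT)
    (bddBelow_range_integral_condExp_two_pow_div hbdd)
  rw [← memLp_one_iff_integrable]
  exact ⟨(stronglyMeasurable_condGrowthRate.mono
      (MeasurableSpace.invariants_le T)).aestronglyMeasurable,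
    (Lp.eLpNorm_le_of_ae_tendsto (Eventually.of_forall hR) (fun l => (hw l).aestronglyMeasurable)
      (hf.ae_tendsto_condExp_two_pow_div hT hbdd)).trans_lt ENNReal.coe_lt_top⟩

theorem lim_integral_eq_integral_condGrowthRate (hf : IsSubadditiveCocycle f T μ)
    (hT : MeasurePreserving T μ μ)
    (hbdd : BddBelow (Set.range fun n : ℕ => (∫ x, f n x ∂μ) / n)) :
    (hf.subadditive_integral hT).lim = ∫ x, condGrowthRate μ T f x ∂μ := by
  have hlim := integral_tendsto_of_tendsto_of_antitone (fun l => integrable_condExp.div_const _)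
    (hf.integrable_condGrowthRate hT hbdd) (hf.ae_antitone_condExp_two_pow_div hT)
    (hf.ae_tendsto_condExp_two_pow_div hT hbdd)
  simp only [integral_condExp_div] at hlim
  exact tendsto_nhds_unique (((hf.subadditive_integral hT).tendsto_lim hbdd).comp
    (tendsto_pow_atTop_atTop_of_one_lt one_lt_two)) hlim

theorem tendsto_integral_div (hf : IsSubadditiveCocycle f T μ) (hT : MeasurePreserving T μ μ)
    (hbdd : BddBelow (Set.range fun n : ℕ => (∫ x, f n x ∂μ) / n)) :
    Tendsto (fun n : ℕ => (∫ x, f n x ∂μ) / n) atTop (𝓝 (∫ x, condGrowthRate μ T f x ∂μ)) := by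
  rw [← hf.lim_integral_eq_integral_condGrowthRate hT hbdd]
  exact (hf.subadditive_integral hT).tendsto_lim hbdd

theorem isGLB_integral_div (hf : IsSubadditiveCocycle f T μ) (hT : MeasurePreserving T μ μ)
    (hbdd : BddBelow (Set.range fun n : ℕ => (∫ x, f n x ∂μ) / n)) :
    IsGLB ((fun n : ℕ => (∫ x, f n x ∂μ) / n) '' Set.Ici 1)
      (∫ x, condGrowthRate μ T f x ∂μ) := by
  rw [← hf.lim_integral_eq_integral_condGrowthRate hT hbdd, Subadditive.lim]
  exact isGLB_csInf (Set.nonempty_Ici.image _) (hbdd.mono (Set.image_subset_range _ _))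

end IsSubadditiveCocycle

/-! ### The upper bound by block averages -/

theorem tendsto_comp_div {a : ℕ → ℝ} {L r : ℝ} {k : ℕ → ℕ}
    (ha : Tendsto (fun n : ℕ => a n / n) atTop (𝓝 L)) (hk : Tendsto k atTop atTop)
    (hkr : Tendsto (fun n : ℕ => (k n : ℝ) / n) atTop (𝓝 r)) :
    Tendsto (fun n : ℕ => a (k n) / n) atTop (𝓝 (L * r)) := by
  refine ((ha.comp hk).mul hkr).congr' ?_
  filter_upwards [hk.eventually_gt_atTop 0] with n hn
  have hkn : (k n : ℝ) ≠ 0 := Nat.cast_ne_zero.2 hn.ne'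
  simp only [Function.comp_apply]
  rw [div_mul_div_cancel₀ hkn]

theorem ne_zero_of_dvd_succ_of_tendsto_atTop {t : ℕ → ℕ} (hdvd : ∀ l, t l ∣ t (l + 1))
    (ht : Tendsto t atTop atTop) (l : ℕ) : t l ≠ 0 := fun hl => by
  obtain ⟨k, hlk, hk⟩ := ((eventually_ge_atTop l).and (ht.eventually_ne_atTop 0)).exists
  have hdvd_of_le : t l ∣ t k := Nat.le_induction dvd_rfl (fun _ _ h => h.trans (hdvd _)) k hlk
  exact hk (zero_dvd_iff.1 (hl ▸ hdvd_of_le))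

theorem tendsto_natCast_div_div_atTop (t : ℕ) :
    Tendsto (fun n : ℕ => ((n / t : ℕ) : ℝ) / n) atTop (𝓝 (1 / t)) := by
  refine ((tendsto_nat_floor_mul_div_atTop (R := ℝ) (a := 1 / t) (by positivity)).comp
    tendsto_natCast_atTop_atTop).congr fun n => ?_
  rw [Function.comp_apply, one_div_mul_eq_div, Nat.floor_div_eq_div]

/-- The limit of the averages of `f t / t` along the orbits of `T^[t]`. -/
noncomputable def blockAverage (μ : Measure α) (T : α → α) (f : ℕ → α → ℝ) (t : ℕ) (x : α) : ℝ :=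
  (μ[f t|MeasurableSpace.invariants T^[t]]) x / t

theorem integrable_blockAverage (t : ℕ) : Integrable (blockAverage μ T f t) μ :=
  integrable_condExp.div_const _

theorem integral_blockAverage [IsFiniteMeasure μ] (t : ℕ) :
    ∫ x, blockAverage μ T f t x ∂μ = (∫ x, f t x ∂μ) / t := by
  simp only [blockAverage]
  rw [integral_div, integral_condExp (MeasurableSpace.invariants_le _)]

namespace IsSubadditiveCocycle

variable [IsFiniteMeasure μ]

theorem ae_tendsto_blockAverage (hf : IsSubadditiveCocycle f T μ) (hT : MeasurePreserving T μ μ)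
    (t : ℕ) : ∀ᵐ x ∂μ, Tendsto (fun k : ℕ => birkhoffSum T^[t] (f t) k x / t / k) atTop
      (𝓝 (blockAverage μ T f t x)) := by
  filter_upwards [ae_tendsto_birkhoffSum_div (hT.iterate t) (hf.integrable t)] with x hx
  exact (hx.div_const (t : ℝ)).congr fun k => div_right_comm _ _ _

theorem ae_eventually_div_lt (hf : IsSubadditiveCocycle f T μ) (hT : MeasurePreserving T μ μ)
    {t : ℕ} (ht : t ≠ 0) :
    ∀ᵐ x ∂μ, ∀ a > blockAverage μ T f t x, ∀ᶠ n : ℕ in atTop, f n x / n < a := by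
  have hdiv : Tendsto (fun n : ℕ => n / t) atTop atTop := Nat.tendsto_div_const_atTop ht
  have htdiv : Tendsto (fun n : ℕ => ((t * (n / t) : ℕ) : ℝ) / n) atTop (𝓝 1) := by
    have := (tendsto_natCast_div_div_atTop t).const_mul (t : ℝ)
    rw [mul_one_div_cancel (Nat.cast_ne_zero.2 ht)] at this
    exact this.congr fun n => by push_cast; ring
  filter_upwards [hf.ae_subadditiveOnOrbit hT, ae_tendsto_birkhoffSum_div hT (hf.integrable 1),
    ae_tendsto_birkhoffSum_div (hT.iterate t) (hf.integrable t)] with x hx hsteps hblocks a ha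
  have hlim := (tendsto_comp_div hblocks hdiv (tendsto_natCast_div_div_atTop t)).add
    (hsteps.sub (tendsto_comp_div hsteps (hdiv.const_mul_atTop' ht.bot_lt) htdiv))
  rw [mul_one, sub_self, add_zero, mul_one_div] at hlim
  filter_upwards [hlim.eventually_lt_const ha] with n hn
  refine lt_of_le_of_lt ?_ hn
  rw [← sub_div, ← add_div]
  gcongr
  exact hx.le_birkhoffSum_blocks_add t n

theorem ae_blockAverage_mul_le (hf : IsSubadditiveCocycle f T μ) (hT : MeasurePreserving T μ μ)
    (t : ℕ) {m : ℕ} (hm : m ≠ 0) :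
    ∀ᵐ x ∂μ, blockAverage μ T f (t * m) x ≤ blockAverage μ T f t x := by
  filter_upwards [hf.ae_subadditiveOnOrbit hT, hf.ae_tendsto_blockAverage hT t,
    hf.ae_tendsto_blockAverage hT (t * m)] with x hx hlim hlim_mul
  have hsub : Tendsto (fun k : ℕ => m * k) atTop atTop :=
    tendsto_id.const_mul_atTop' hm.bot_lt
  refine le_of_tendsto_of_tendsto' hlim_mul (hlim.comp hsub) fun k => ?_
  rw [Function.comp_apply, div_div, div_div, Nat.cast_mul, Nat.cast_mul, mul_assoc]
  gcongr
  exact hx.birkhoffSum_mul_le t m k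

theorem ae_eventually_lt_div_of_lt_condGrowthRate (hf : IsSubadditiveCocycle f T μ)
    (hT : MeasurePreserving T μ μ)
    (hbdd : BddBelow (Set.range fun n : ℕ => (∫ x, f n x ∂μ) / n)) :
    ∀ᵐ x ∂μ, ∀ a < condGrowthRate μ T f x, ∀ᶠ n : ℕ in atTop, a < f n x / n :=
  hf.ae_eventually_lt_div hT (hf.integrable_condGrowthRate hT hbdd)
    stronglyMeasurable_condGrowthRate (hf.ae_mul_condGrowthRate_le hT hbdd)

theorem ae_condGrowthRate_le_blockAverage (hf : IsSubadditiveCocycle f T μ)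
    (hT : MeasurePreserving T μ μ)
    (hbdd : BddBelow (Set.range fun n : ℕ => (∫ x, f n x ∂μ) / n)) {t : ℕ} (ht : t ≠ 0) :
    ∀ᵐ x ∂μ, condGrowthRate μ T f x ≤ blockAverage μ T f t x := by
  filter_upwards [hf.ae_eventually_lt_div_of_lt_condGrowthRate hT hbdd,
    hf.ae_eventually_div_lt hT ht] with x hlower hupper
  by_contra! hlt
  obtain ⟨a, ha, ha'⟩ := exists_between hlt
  obtain ⟨n, hn, hn'⟩ := ((hupper a ha).and (hlower a ha')).exists
  exact hn.not_gt hn'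

/-- The block averages decrease along `t` and their integrals tend to that of the growth rate,
which bounds them below. -/
theorem ae_tendsto_blockAverage_condGrowthRate (hf : IsSubadditiveCocycle f T μ)
    (hT : MeasurePreserving T μ μ)
    (hbdd : BddBelow (Set.range fun n : ℕ => (∫ x, f n x ∂μ) / n)) {t : ℕ → ℕ}
    (hdvd : ∀ l, t l ∣ t (l + 1)) (ht : Tendsto t atTop atTop) :
    ∀ᵐ x ∂μ, Tendsto (fun l => blockAverage μ T f (t l) x) atTop (𝓝 (condGrowthRate μ T f x)) := by
  have ht₀ := ne_zero_of_dvd_succ_of_tendsto_atTop hdvd ht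
  refine tendsto_of_integral_tendsto_of_antitone (fun l => integrable_blockAverage _)
    (hf.integrable_condGrowthRate hT hbdd) ?_ ?_
    (ae_all_iff.2 fun l => hf.ae_condGrowthRate_le_blockAverage hT hbdd (ht₀ l))
  · simp only [integral_blockAverage]
    exact (hf.tendsto_integral_div hT hbdd).comp ht
  · choose m hm using hdvd
    have hm₀ (l : ℕ) : m l ≠ 0 := fun h => ht₀ (l + 1) (by rw [hm, h, mul_zero])
    filter_upwards [ae_all_iff.2 fun l => hf.ae_blockAverage_mul_le hT (t l) (hm₀ l)] with x hx
    exact antitone_nat_of_succ_le fun l => by rw [hm]; exact hx l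

theorem ae_tendsto_div_condGrowthRate (hf : IsSubadditiveCocycle f T μ)
    (hT : MeasurePreserving T μ μ)
    (hbdd : BddBelow (Set.range fun n : ℕ => (∫ x, f n x ∂μ) / n)) :
    ∀ᵐ x ∂μ, Tendsto (fun n : ℕ => f n x / n) atTop (𝓝 (condGrowthRate μ T f x)) := by
  have hblock := hf.ae_tendsto_blockAverage_condGrowthRate hT hbdd
    (fun l => pow_dvd_pow 2 l.le_succ) (tendsto_pow_atTop_atTop_of_one_lt one_lt_two)
  filter_upwards [hf.ae_eventually_lt_div_of_lt_condGrowthRate hT hbdd, hblock,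
    ae_all_iff.2 fun l => hf.ae_eventually_div_lt hT (Nat.two_pow_pos l).ne']
    with x hlower hx hupper
  refine tendsto_order.2 ⟨hlower, fun a ha => ?_⟩
  obtain ⟨l, hl⟩ := (hx.eventually_lt_const ha).exists
  exact hupper l a hl

end IsSubadditiveCocycle

/-! ### Extended real cocycles -/

theorem measurable_ereal_abs : Measurable EReal.abs :=
  EReal.measurable_of_measurable_real <| by
    simpa only [EReal.abs_def, id_eq] using measurable_id.abs.ennreal_ofReal

theorem ae_coe_toReal_eq {u : α → EReal} (hu : AEMeasurable u μ) (hint : ∫⁻ x, (u x).abs ∂μ < ⊤) :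
    ∀ᵐ x ∂μ, ((u x).toReal : EReal) = u x := by
  filter_upwards [ae_lt_top' (measurable_ereal_abs.comp_aemeasurable hu) hint.ne] with x hx
  refine EReal.coe_toReal ?_ ?_ <;> intro h <;> simp [h] at hx

theorem integrable_toReal_of_lintegral_abs_lt_top {u : α → EReal} (hu : AEMeasurable u μ)
    (hint : ∫⁻ x, (u x).abs ∂μ < ⊤) : Integrable (fun x => (u x).toReal) μ := by
  refine ⟨hu.ereal_toReal.aestronglyMeasurable, ?_⟩
  refine (lintegral_congr_ae ?_).trans_lt hint
  filter_upwards [ae_coe_toReal_eq hu hint] with x hx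
  rw [Real.enorm_eq_ofReal_abs, ← EReal.abs_def, hx]

theorem bddBelow_range_integral_toReal_div {φ : ℕ → α → EReal}
    (hmeas : ∀ n, 1 ≤ n → AEMeasurable (φ n) μ) (hint : ∀ n, 1 ≤ n → ∫⁻ x, (φ n x).abs ∂μ < ⊤)
    (hg : Integrable g μ) (hle : ∀ n : ℕ, 1 ≤ n → ∀ᵐ x ∂μ, (g x : EReal) ≤ φ n x / (n : EReal)) :
    BddBelow (Set.range fun n : ℕ => (∫ x, (φ n x).toReal ∂μ) / n) := by
  refine ⟨min (∫ x, g x ∂μ) 0, Set.forall_mem_range.2 fun n => ?_⟩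
  rcases Nat.eq_zero_or_pos n with rfl | hn
  · simp
  · refine (min_le_left _ _).trans ?_
    rw [← integral_div]
    refine integral_mono_ae hg
      ((integrable_toReal_of_lintegral_abs_lt_top (hmeas n hn) (hint n hn)).div_const _) ?_
    filter_upwards [hle n hn, ae_coe_toReal_eq (hmeas n hn) (hint n hn)] with x hx hcoe
    rwa [← hcoe, ← EReal.coe_coe_eq_natCast, ← EReal.coe_div, EReal.coe_le_coe_iff] at hx

/-- The real-valued version of an extended real cocycle which is only given for `n ≥ 1`. -/
noncomputable def toRealCocycle (φ : ℕ → α → EReal) (n : ℕ) : α → ℝ :=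
  if n = 0 then 0 else fun x => (φ n x).toReal

theorem integral_toRealCocycle_div (φ : ℕ → α → EReal) (n : ℕ) :
    (∫ x, toRealCocycle φ n x ∂μ) / n = (∫ x, (φ n x).toReal ∂μ) / n := by
  rcases eq_or_ne n 0 with rfl | hn
  · simp
  · simp only [toRealCocycle, if_neg hn]

theorem ae_forall_coe_toRealCocycle_iterate (hT : MeasurePreserving T μ μ) {φ : ℕ → α → EReal}
    (hmeas : ∀ n, 1 ≤ n → AEMeasurable (φ n) μ)
    (hint : ∀ n, 1 ≤ n → ∫⁻ x, (φ n x).abs ∂μ < ⊤) :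
    ∀ᵐ x ∂μ, ∀ i n, 1 ≤ n → (toRealCocycle φ n (T^[i] x) : EReal) = φ n (T^[i] x) := by
  refine ae_forall_iterate_of_ae hT
    (p := fun x => ∀ n, 1 ≤ n → (toRealCocycle φ n x : EReal) = φ n x)
    (ae_all_iff.2 fun n => eventually_imp_distrib_left.2 fun hn => ?_)
  simpa only [toRealCocycle, if_neg (Nat.one_le_iff_ne_zero.1 hn)] using
    ae_coe_toReal_eq (hmeas n hn) (hint n hn)

theorem isSubadditiveCocycle_toRealCocycle (hT : MeasurePreserving T μ μ) {φ : ℕ → α → EReal}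
    (hmeas : ∀ n, 1 ≤ n → AEMeasurable (φ n) μ)
    (hsub : ∀ k₁ k₂, 1 ≤ k₁ → 1 ≤ k₂ →
      ∀ᵐ x ∂μ, φ (k₁ + k₂) x ≤ φ k₁ x + φ k₂ (T^[k₁] x))
    (hint : ∀ n, 1 ≤ n → ∫⁻ x, (φ n x).abs ∂μ < ⊤) :
    IsSubadditiveCocycle (toRealCocycle φ) T μ where
  zero := by ext x; simp [toRealCocycle]
  integrable n := by
    rcases Nat.eq_zero_or_pos n with rfl | hn
    · simp [toRealCocycle]
    · simpa only [toRealCocycle, if_neg hn.ne'] using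
        integrable_toReal_of_lintegral_abs_lt_top (hmeas n hn) (hint n hn)
  add_le m n := by
    rcases Nat.eq_zero_or_pos m with rfl | hm
    · simp [toRealCocycle]
    rcases Nat.eq_zero_or_pos n with rfl | hn
    · simp [toRealCocycle]
    filter_upwards [hsub m n hm hn, ae_forall_coe_toRealCocycle_iterate hT hmeas hint]
      with x hx hcoe
    have hsum := hcoe 0 (m + n) (by omega)
    have hfst := hcoe 0 m hm
    rw [Function.iterate_zero_apply] at hsum hfst
    rw [← hsum, ← hfst, ← hcoe m n hn] at hx
    exact_mod_cast hx

theorem coe_birkhoffSum_div_div {φ : ℕ → α → EReal} {x : α} {t : ℕ} (ht : 1 ≤ t)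
    (hx : ∀ i n, 1 ≤ n → (toRealCocycle φ n (T^[i] x) : EReal) = φ n (T^[i] x)) (k : ℕ) :
    ((birkhoffSum T^[t] (toRealCocycle φ t) k x / t / k : ℝ) : EReal) =
      (∑ j ∈ Finset.range k, φ t (T^[j * t] x) / (t : EReal)) / (k : EReal) := by
  let coeHom : ℝ →+ EReal := ⟨⟨Real.toEReal, EReal.coe_zero⟩, EReal.coe_add⟩
  rw [birkhoffSum, Finset.sum_div, EReal.coe_div, EReal.coe_coe_eq_natCast]
  congr 1
  refine (map_sum coeHom _ _).trans (Finset.sum_congr rfl fun j _ => ?_)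
  change ((toRealCocycle φ t ((T^[t])^[j] x) / t : ℝ) : EReal) = _
  rw [← Function.iterate_mul, mul_comm t, EReal.coe_div, EReal.coe_coe_eq_natCast, hx _ _ ht]

theorem tendsto_atTop_of_succ_eq_two_mul {t : ℕ → ℕ} (ht₁ : 1 ≤ t 1)
    (ht : ∀ l, 1 ≤ l → t (l + 1) = 2 * t l) : Tendsto t atTop atTop := by
  refine tendsto_atTop_mono' atTop ?_ tendsto_id
  filter_upwards [eventually_ge_atTop 1] with l hl
  induction l, hl using Nat.le_induction with
  | base => exact ht₁
  | succ l hl ih => rw [ht l hl]; simp only [id_eq] at ih ⊢; omega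

theorem exists_measurableSet_forall_of_ae {p : α → Prop} (hp : ∀ᵐ x ∂μ, p x) :
    ∃ s, MeasurableSet s ∧ μ s = μ Set.univ ∧ ∀ x ∈ s, p x := by
  obtain ⟨s, hs, hsm, hs₀⟩ := exists_measurable_superset_of_null (ae_iff.1 hp)
  exact ⟨sᶜ, hsm.compl, measure_congr (ae_eq_univ.2 (by rwa [compl_compl])),
    fun x hx => by_contra fun hpx => hx (hs hpx)⟩

end Cocycle

theorem lemma2p4_general {X : Type*} [MeasurableSpace X] (μ : Measure X) [IsFiniteMeasure μ]
    (θ : X → X) (hθ : MeasurePreserving θ μ μ)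
    (t : ℕ → ℕ) (ht : ∀ l, 1 ≤ l → t l ∣ t (l + 1)) (ht_top : Tendsto t atTop atTop)
    (φ : ℕ → X → EReal) (hφ_meas : ∀ n, 1 ≤ n → AEMeasurable (φ n) μ)
    (hφ_sub : ∀ k₁ k₂, 1 ≤ k₁ → 1 ≤ k₂ →
      ∀ᵐ x ∂μ, φ (k₁ + k₂) x ≤ φ k₁ x + φ k₂ (θ^[k₁] x))
    (hφ_int : ∀ n, 1 ≤ n → ∫⁻ x, (φ n x).abs ∂μ < ⊤)
    (hφ_bdd : BddBelow (Set.range fun n : ℕ => (∫ x, (φ n x).toReal ∂μ) / n)) :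
    ∃ φbar : X → ℝ, Measurable φbar ∧ Integrable φbar μ ∧
      Tendsto (fun n : ℕ => (∫ x, (φ n x).toReal ∂μ) / (n : ℝ)) atTop (𝓝 (∫ x, φbar x ∂μ)) ∧
      IsGLB ((fun n : ℕ => (∫ x, (φ n x).toReal ∂μ) / (n : ℝ)) '' Set.Ici 1)
        (∫ x, φbar x ∂μ) ∧
      ∃ Γ : Set X, MeasurableSet Γ ∧ μ Γ = μ Set.univ ∧ ∀ x ∈ Γ,
        Tendsto (fun n : ℕ => φ n x / (n : EReal)) atTop (𝓝 (φbar x : EReal)) ∧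
        (∀ n : ℕ, 0 < n → φbar (θ^[n] x) = φbar x) ∧
        ∃ h : ℕ → ℝ,
          (∀ l, 1 ≤ l →
            Tendsto
              (fun k : ℕ =>
                (∑ j ∈ Finset.range k, φ (t l) (θ^[j * t l] x) / (t l : EReal)) / (k : EReal))
              atTop (𝓝 (h l : EReal))) ∧
          Tendsto h atTop (𝓝 (φbar x)) := by
  have hf := isSubadditiveCocycle_toRealCocycle hθ hφ_meas hφ_sub hφ_int
  simp only [← integral_toRealCocycle_div] at hφ_bdd ⊢
  have hdvd (l : ℕ) : t (l + 1) ∣ t (l + 1 + 1) := ht _ l.succ_pos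
  have ht_shift := ht_top.comp (tendsto_add_atTop_nat 1)
  refine ⟨condGrowthRate μ θ (toRealCocycle φ),
    (stronglyMeasurable_condGrowthRate.mono (MeasurableSpace.invariants_le θ)).measurable,
    hf.integrable_condGrowthRate hθ hφ_bdd, hf.tendsto_integral_div hθ hφ_bdd,
    hf.isGLB_integral_div hθ hφ_bdd, exists_measurableSet_forall_of_ae ?_⟩
  filter_upwards [hf.ae_tendsto_div_condGrowthRate hθ hφ_bdd,
    hf.ae_tendsto_blockAverage_condGrowthRate hθ hφ_bdd hdvd ht_shift,
    ae_all_iff.2 fun l => hf.ae_tendsto_blockAverage hθ (t l),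
    ae_forall_coe_toRealCocycle_iterate hθ hφ_meas hφ_int] with x hlim houter hinner hcoe
  refine ⟨(EReal.tendsto_coe.2 hlim).congr' ?_, fun n _ => condGrowthRate_iterate n x,
    fun l => blockAverage μ θ (toRealCocycle φ) (t l) x, fun l hl => ?_,
    (tendsto_add_atTop_iff_nat 1).1 houter⟩
  · filter_upwards [eventually_ge_atTop 1] with n hn
    rw [EReal.coe_div, EReal.coe_coe_eq_natCast]
    exact congrArg (· / (n : EReal)) (hcoe 0 n hn)
  · obtain ⟨l, rfl⟩ := Nat.exists_eq_add_of_le' hl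
    have htl := ne_zero_of_dvd_succ_of_tendsto_atTop hdvd ht_shift l
    exact (EReal.tendsto_coe.2 (hinner _)).congr
      (coe_birkhoffSum_div_div (Nat.one_le_iff_ne_zero.2 htl) hcoe)

theorem lemma2p4 {X : Type*} [TopologicalSpace X] [CompactSpace X]
    [TopologicalSpace.MetrizableSpace X] [MeasurableSpace X] [BorelSpace X]
    (μ : Measure X) [IsProbabilityMeasure μ]
    (θ : X → X) (hθ : MeasurePreserving θ μ μ)
    (t : ℕ → ℕ) (ht₁ : 1 ≤ t 1) (ht : ∀ l, 1 ≤ l → t (l + 1) = 2 * t l)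
    -- `φ n x` takes values in `ℝ ∪ {-∞}`, i.e. in `EReal` without `⊤`
    (φ : ℕ → X → EReal) (hφ_top : ∀ n, 1 ≤ n → ∀ x, φ n x ≠ ⊤)
    (hφ_meas : ∀ n, 1 ≤ n → Measurable (φ n))
    (hφ_sub : ∀ k₁ k₂, 1 ≤ k₁ → 1 ≤ k₂ →
      ∀ᵐ x ∂μ, φ (k₁ + k₂) x ≤ φ k₁ x + φ k₂ (θ^[k₁] x))
    -- (a) every `φ n` is integrable
    (hφ_int : ∀ n, 1 ≤ n → ∫⁻ x, (φ n x).abs ∂μ < ⊤)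
    -- (b) the functions `φ n / n` have a common integrable lower bound
    (hφ_bdd : ∃ g : X → ℝ, Integrable g μ ∧
      ∀ n : ℕ, 1 ≤ n → ∀ᵐ x ∂μ, (g x : EReal) ≤ φ n x / (n : EReal)) :
    ∃ φbar : X → ℝ, Measurable φbar ∧ Integrable φbar μ ∧
      Tendsto (fun n : ℕ => (∫ x, (φ n x).toReal ∂μ) / (n : ℝ)) atTop (𝓝 (∫ x, φbar x ∂μ)) ∧
      IsGLB ((fun n : ℕ => (∫ x, (φ n x).toReal ∂μ) / (n : ℝ)) '' Set.Ici 1)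
        (∫ x, φbar x ∂μ) ∧
      ∃ Γ : Set X, MeasurableSet Γ ∧ μ Γ = 1 ∧ ∀ x ∈ Γ,
        Tendsto (fun n : ℕ => φ n x / (n : EReal)) atTop (𝓝 (φbar x : EReal)) ∧
        (∀ n : ℕ, 0 < n → φbar (θ^[n] x) = φbar x) ∧
        ∃ h : ℕ → ℝ,
          (∀ l, 1 ≤ l →
            Tendsto
              (fun k : ℕ =>
                (∑ j ∈ Finset.range k, φ (t l) (θ^[j * t l] x) / (t l : EReal)) / (k : EReal))
              atTop (𝓝 (h l : EReal))) ∧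
          Tendsto h atTop (𝓝 (φbar x)) := by
  obtain ⟨g, hg, hgφ⟩ := hφ_bdd
  have hmeas (n : ℕ) (hn : 1 ≤ n) : AEMeasurable (φ n) μ := (hφ_meas n hn).aemeasurable
  simpa only [measure_univ] using lemma2p4_general μ θ hθ t
    (fun l hl => ⟨2, by rw [ht l hl, mul_comm]⟩) (tendsto_atTop_of_succ_eq_two_mul ht₁ ht) φ hmeas
    hφ_sub hφ_int (bddBelow_range_integral_toReal_div hmeas hφ_int hg hgφ)
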